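/- **Setting.** Let $\Omega\subset\mathbb R^2$ be open and bounded, $\Omega_{\rm a}\subset\Omega$ open, and $\Omega_{\rm c}=\Omega\setminus\overline{\Omega_{\rm a}}$. Assume that $\Omega_{\rm c}$ is a polygonal region with a triangulation $\mathcal T$ whose vertices lie in $\mathbb Z^2$: $\mathcal T$ is a finite set of non-degenerate closed triangles with vertices in $\mathbb Z^2$ and pairwise disjoint interiors, and $\Omega_{\rm c}$ is the interior of their union. Let $\mathcal R\subset\mathbb Z^2\setminus\{0\}$ be finite, write $(i,i+r)$ for the open segment between $i$ and $i+r$, and assume that for all $r\in\mathcal R$ and $i\in\mathbb Z^2$ with $(i,i+r)\cap\overline{\Omega_{\rm c}}\neq\emptyset$ one has $i,i+r\in\Omega$. Let $$\mathcal B=\{b=(i,i+r):\ r\in\mathcal R,\ i\in\Omega\cap\mathbb Z^2,\ i+r\in\Omega\cap\mathbb Z^2\}$$ be the set of bonds, a bond being recorded together with its $i$ and $r$ (so $(i,i+r)$ and $(i+r,i)$ count separately if $\pm r\in\mathcal R$). Let $\varphi$ be a real function (the two-body potential), $\phi(z)=\varphi(|z|)$ for $z\in\mathbb R^2$, and let $y$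 be a deformation with values in $\mathbb R^2$, given on $\overline{\Omega_{\rm c}}$ and at the lattice points of $\Omega$, and affine on every $T\in\mathcal T$ (so $y\in\mathcal P_1(\mathcal T)$ on $\overline{\Omega_{\rm c}}$). Put $D_ry(x)=\lim_{\varepsilon\to0}\frac{y(x+\varepsilon r)-y(x)}{\varepsilon}$, and for $b=(i,i+r)$ put $$\langle f\rangle_b=\int_0^1 f(i+\lambda r)\,d\lambda,\qquad \chi_{\Omega_{\rm c}}(x)=\lim_{\rho\to0}\frac{|\Omega_{\rm c}\cap B_\rho(x)|}{|B_\rho(x)|},$$ $$e_b(y)=\phi(y_{i+r}-y_i),\qquad c_b(y)=\langle\chi_{\Omega_{\rm c}}\,\phi(D_ry)\rangle_b,$$ where the integrand of $c_b$ is $0$ outside $\overline{\Omega_{\rm c}}$. The ECC energy is $$E^{\rm ecc}(y)=\sum_{b\in\mathcal B,\ b\not\subset\Omega_{\rm c}}e_b(y)+\sum_{b\in\mathcal B,\ b\subset\Omega_{\rm c}}\langle\phi(D_ry)\rangle_b.$$ **Theorem.** The contributions $c_b(y)$, $b\in\mathcal B$, are well defined (the integrand is integrable over $b$), with $c_b(y)=\langle\phi(D_ry)\rangle_b$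 if $b\subset\Omega_{\rm c}$. The Cauchy–Born energy $$E_{\rm c}(y)=\int_{\Omega_{\rm c}}\sum_{r\in\mathcal R}\phi(D_ry)\,d\Omega=\sum_{T\in\mathcal T}\sum_{r\in\mathcal R}|T|\,\phi(D_ry|_T)$$ is well defined (the integrand is integrable and the two expressions agree), and $$E^{\rm ecc}(y)=\sum_{b\in\mathcal B,\ b\not\subset\Omega_{\rm c}}\bigl(e_b(y)-c_b(y)\bigr)+E_{\rm c}(y).$$ Moreover, $E^{\rm ecc}(y)$ can be computed at a cost proportional to the number of bonds not contained in $\Omega_{\rm c}$ plus the number of triangles: for given $\Omega,\Omega_{\rm a},\mathcal T,\mathcal R$ there is a straight-line computation, the same for all $\varphi$ and $y$, whose inputs are fixed real constants (depending on the geometry only) and coordinates of the values of $y$ at lattice points, whose operations are additions, subtractions, multiplications and evaluations $z\mapsto\varphi(|z|)$, which returns $E^{\rm ecc}(y)$ and performs at most $$20\,\bigl(\#\{b\in\mathcal B:\ b\not\subset\Omega_{\rm c}\}+\#\mathcal R\cdot\#\mathcal T\bigr)$$ operations. -/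

import Mathlib

open MeasureTheory Filter Topology

noncomputable section

namespace ECC

/-- The plane `ℝ²` with its Euclidean norm. -/
abbrev Plane := EuclideanSpace ℝ (Fin 2)

/-- The lattice `ℤ²`. -/
abbrev Lattice := Fin 2 → ℤ

/-- The reference position `x_i = i ∈ ℝ²` of the lattice point `i ∈ ℤ²`. -/
def site (i : Lattice) : Plane := WithLp.toLp 2 fun k => (i k : ℝ)

/-- The closed triangle (convex hull) spanned by a finite set of lattice points. -/
def tri (T : Finset Lattice) : Set Plane := convexHull ℝ (site '' (T : Set Lattice))

/-- `𝒯` is a triangulation of the polygonal region `ω`: finitely many non-degenerate triangles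
with lattice vertices (a triangle being given by its set of three vertices), which do not overlap
and fill `ω`. In particular this is the case for every conforming (edge-to-edge) triangulation,
but hanging nodes are not excluded. -/
structure IsTriangulation (𝒯 : Finset (Finset Lattice)) (ω : Set Plane) : Prop where
  card_eq : ∀ T ∈ 𝒯, T.card = 3
  nondegenerate : ∀ T ∈ 𝒯, AffineIndependent ℝ fun v : T => site v
  nonoverlapping : ∀ T ∈ 𝒯, ∀ T' ∈ 𝒯, T ≠ T' → Disjoint (interior (tri T)) (interior (tri T'))
  region_eq : ω = interior (⋃ T ∈ 𝒯, tri T)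

/-- `y` is a continuous piecewise affine function on the triangulated region: it agrees with an
affine map on each closed triangle (so it is continuous on their union). Its values elsewhere are
unrestricted. -/
def IsP1 (𝒯 : Finset (Finset Lattice)) (y : Plane → Plane) : Prop :=
  ∀ T ∈ 𝒯, ∃ A : Plane →ᵃ[ℝ] Plane, Set.EqOn y A (tri T)

/-- The open segment `(i, i + r)`; a bond `b = (i, i + r)` is recorded as the pair `(i, r)`. -/
def seg (b : Lattice × Lattice) : Set Plane := openSegment ℝ (site b.1) (site (b.1 + b.2))

/-- The collection of all bonds `(i, i + r)` with `r ∈ R` and `i, i + r ∈ Ω ∩ ℤ²`. -/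
def bonds (Ω : Set Plane) (R : Finset Lattice) : Set (Lattice × Lattice) :=
  {b | b.2 ∈ R ∧ site b.1 ∈ Ω ∧ site (b.1 + b.2) ∈ Ω}

/-- The bonds contained in `Ωc`. -/
def innerBonds (Ω Ωc : Set Plane) (R : Finset Lattice) : Set (Lattice × Lattice) :=
  {b ∈ bonds Ω R | seg b ⊆ Ωc}

/-- The bonds not contained in `Ωc`. -/
def outerBonds (Ω Ωc : Set Plane) (R : Finset Lattice) : Set (Lattice × Lattice) :=
  {b ∈ bonds Ω R | ¬ seg b ⊆ Ωc}

/-- The directional derivative `D_r y (x) = lim_{ε → 0} (y (x + ε r) - y (x)) / ε`. -/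
def dirDeriv (r : Lattice) (y : Plane → Plane) (x : Plane) : Plane := lineDeriv ℝ y x (site r)

/-- The point `(1 - t) i + t (i + r)` of the bond `(i, i + r)`. -/
def bondPoint (b : Lattice × Lattice) (t : ℝ) : Plane :=
  (1 - t) • site b.1 + t • site (b.1 + b.2)

/-- The average over a bond. -/
def bondAverage (b : Lattice × Lattice) (f : Plane → ℝ) : ℝ :=
  ∫ t in (0 : ℝ)..1, f (bondPoint b t)

/-- The characteristic function of a polygonal set, `lim_{ρ → 0} |ω ∩ B_ρ(x)| / |B_ρ(x)|`. -/
def chi (ω : Set Plane) (x : Plane) : ℝ :=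
  limUnder (𝓝[>] (0 : ℝ)) fun ρ =>
    volume.real (ω ∩ Metric.ball x ρ) / volume.real (Metric.ball x ρ)

/-- The exact contribution `e_b(y) = φ(|y_{i+r} - y_i|)` of the bond `b = (i, i + r)`. -/
def exactContrib (φ : ℝ → ℝ) (y : Plane → Plane) (b : Lattice × Lattice) : ℝ :=
  φ ‖y (site (b.1 + b.2)) - y (site b.1)‖

/-- The continuum contribution of a bond `b` contained in the continuum region: the average over
`b` of `φ(|D_r y|)`. -/
def innerContContrib (φ : ℝ → ℝ) (y : Plane → Plane) (b : Lattice × Lattice) : ℝ :=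
  bondAverage b fun x => φ ‖dirDeriv b.2 y x‖

/-- The integrand `χ_{Ωc} φ(|D_r y|)` of the extended continuum contribution of `b`. It vanishes
outside the closure of `Ωc`, whatever `y` is there. -/
def contDensity (Ωc : Set Plane) (φ : ℝ → ℝ) (y : Plane → Plane) (b : Lattice × Lattice)
    (x : Plane) : ℝ :=
  chi Ωc x * φ ‖dirDeriv b.2 y x‖

/-- The continuum contribution `c_b(y)` of an arbitrary bond `b`: the average over `b` of
`χ_{Ωc} φ(|D_r y|)`. -/
def contContrib (Ωc : Set Plane) (φ : ℝ → ℝ) (y : Plane → Plane) (b : Lattice × Lattice) : ℝ :=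
  bondAverage b (contDensity Ωc φ y b)

/-- The energy of the ECC method: exact contributions of the bonds not contained in `Ωc`, plus
continuum contributions of the bonds contained in `Ωc`. -/
def eccEnergy (Ω Ωc : Set Plane) (R : Finset Lattice) (φ : ℝ → ℝ) (y : Plane → Plane) : ℝ :=
  (∑ᶠ b ∈ outerBonds Ω Ωc R, exactContrib φ y b) + ∑ᶠ b ∈ innerBonds Ω Ωc R, innerContContrib φ y b

/-- The Cauchy--Born energy density `∑_{r ∈ R} φ(|D_r y|)`. -/
def cauchyBornDensity (R : Finset Lattice) (φ : ℝ → ℝ) (y : Plane → Plane) (x : Plane) : ℝ :=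
  ∑ r ∈ R, φ ‖dirDeriv r y x‖

/-- The Cauchy--Born continuum energy, as an integral over `Ωc`. -/
def contEnergy (Ωc : Set Plane) (R : Finset Lattice) (φ : ℝ → ℝ) (y : Plane → Plane) : ℝ :=
  ∫ x in Ωc, cauchyBornDensity R φ y x

/-- The barycenter of a triangle. -/
def barycenter (T : Finset Lattice) : Plane := (3 : ℝ)⁻¹ • ∑ v ∈ T, site v

/-- The Cauchy--Born continuum energy, assembled over the triangles:
`∑_T ∑_r |T| φ(|D_r y|_T|)`. The constant value `D_r y|_T` is taken at the barycenter of `T`. -/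
def contEnergyTri (𝒯 : Finset (Finset Lattice)) (R : Finset Lattice) (φ : ℝ → ℝ)
    (y : Plane → Plane) : ℝ :=
  ∑ T ∈ 𝒯, ∑ r ∈ R, volume.real (tri T) * φ ‖dirDeriv r y (barycenter T)‖

/-- Straight-line computations with real numbers: the inputs are real constants and the
coordinates of the positions `y_i` at lattice points, the operations are addition, subtraction,
multiplication and the evaluation of the two-body potential at a vector of the plane. -/
inductive Computation : Type
  | const (a : ℝ) : Computation
  | coord (i : Lattice) (k : Fin 2) : Computation
  | add (p q : Computation) : Computation
  | sub (p q : Computation) : Computation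
  | mul (p q : Computation) : Computation
  | potential (p q : Computation) : Computation

/-- The value computed for the potential `φ` and the deformation `y`. -/
def Computation.value (φ : ℝ → ℝ) (y : Plane → Plane) : Computation → ℝ
  | .const a => a
  | .coord i k => y (site i) k
  | .add p q => p.value φ y + q.value φ y
  | .sub p q => p.value φ y - q.value φ y
  | .mul p q => p.value φ y * q.value φ y
  | .potential p q => φ ‖(!₂[p.value φ y, q.value φ y] : Plane)‖

/-- The number of operations performed. -/
def Computation.cost : Computation → ℕ
  | .const _ => 0
  | .coord _ _ => 0
  | .add p q => p.cost + q.cost + 1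
  | .sub p q => p.cost + q.cost + 1
  | .mul p q => p.cost + q.cost + 1
  | .potential p q => p.cost + q.cost + 1

/-- A bounded region has finitely many bonds, so that the sums over bonds are finite sums. -/
theorem bonds_finite {Ω : Set Plane} (hΩ : Bornology.IsBounded Ω) (R : Finset Lattice) :
    (bonds Ω R).Finite := by
  obtain ⟨M, hM⟩ := hΩ.exists_norm_le
  have hI : {i : Lattice | site i ∈ Ω}.Finite := by
    refine (Set.finite_Icc (fun _ => -⌈M⌉ : Lattice) (fun _ => ⌈M⌉)).subset fun i hi => ?_
    have h : ∀ k, |(i k : ℝ)| ≤ (⌈M⌉ : ℝ) := fun k =>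
      ((PiLp.norm_apply_le (site i) k).trans (hM _ hi)).trans (Int.le_ceil M)
    exact ⟨fun k => by have := (abs_le.1 (h k)).1; exact_mod_cast this,
      fun k => by have := (abs_le.1 (h k)).2; exact_mod_cast this⟩
  exact (hI.prod R.finite_toSet).subset fun b hb => ⟨hb.2.1, hb.1⟩

end ECC

end

/-!
For a lattice triangle `T`, let `S w = ∑_{i ∈ ℤ²} χ_T (i + w)`. The triangle and its point
reflection tile a lattice parallelogram, every translate of which contains, up to null sets, exactly
as many lattice points as its area; averaging over small balls turns this into
`S w + S (-w) = 2 |T|` for *every* `w`. Since `S` is `ℤ²`-periodic, `S (-t r) = S ((1 - t) r)`, and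
integrating over `t ∈ [0, 1]` gives `∫ S (t r) dt = |T|`: the bonds of direction `r` cover every
triangle with unit density.

The boundary hypothesis says that no bond meeting the closed continuum region is missing from the
sum, so the contributions `c_b` of all bonds add up to the Cauchy–Born energy. For the cost, the
contributions of the inner bonds are collected in advance into one fixed coefficient for each
triangle and direction.
-/

namespace ECC

open scoped ENNReal

section BallDensity

variable {E : Type*} [NormedAddCommGroup E] [MeasurableSpace E] {μ : Measure E} {A : Set E} {x : E}

/-- The fraction of the ball of radius `ρ` about `x` that is filled by `A`. Its limit as `ρ → 0` is
the value at `x` of the characteristic function `chi`. -/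
noncomputable def ballDensity (μ : Measure E) (A : Set E) (x : E) (ρ : ℝ) : ℝ :=
  μ.real (A ∩ Metric.ball x ρ) / μ.real (Metric.ball x ρ)

theorem ballDensity_nonneg (μ : Measure E) (A : Set E) (x : E) (ρ : ℝ) :
    0 ≤ ballDensity μ A x ρ :=
  div_nonneg measureReal_nonneg measureReal_nonneg

theorem tendsto_ballDensity_of_notMem_closure (h : x ∉ closure A) :
    Tendsto (ballDensity μ A x) (𝓝[>] 0) (𝓝 0) := by
  obtain ⟨ε, hε, hA⟩ := Metric.mem_nhds_iff.1 (isClosed_closure.isOpen_compl.mem_nhds h)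
  refine tendsto_const_nhds.congr' ?_
  filter_upwards [Ioo_mem_nhdsGT hε] with ρ hρ
  have hempty : A ∩ Metric.ball x ρ = ∅ :=
    Set.disjoint_iff_inter_eq_empty.1 <| Set.disjoint_left.2 fun z hzA hz =>
      hA (Metric.ball_subset_ball hρ.2.le hz) (subset_closure hzA)
  simp [ballDensity, hempty]

section ProperSpace

variable [ProperSpace E] [IsFiniteMeasureOnCompacts μ]

variable (μ A x) in
theorem ballDensity_le_one (ρ : ℝ) : ballDensity μ A x ρ ≤ 1 :=
  div_le_one_of_le₀ (measureReal_mono Set.inter_subset_right measure_ball_lt_top.ne)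
    measureReal_nonneg

theorem measureReal_ball_pos [μ.IsOpenPosMeasure] (x : E) {ρ : ℝ} (hρ : 0 < ρ) :
    0 < μ.real (Metric.ball x ρ) :=
  ENNReal.toReal_pos (Metric.measure_ball_pos μ x hρ).ne' measure_ball_lt_top.ne

theorem tendsto_ballDensity_of_mem_nhds [μ.IsOpenPosMeasure] (h : A ∈ 𝓝 x) :
    Tendsto (ballDensity μ A x) (𝓝[>] 0) (𝓝 1) := by
  obtain ⟨ε, hε, hA⟩ := Metric.mem_nhds_iff.1 h
  refine tendsto_const_nhds.congr' ?_
  filter_upwards [Ioo_mem_nhdsGT hε] with ρ hρ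
  have hsub : Metric.ball x ρ ⊆ A := (Metric.ball_subset_ball hρ.2.le).trans hA
  rw [ballDensity, Set.inter_eq_right.2 hsub, div_self (measureReal_ball_pos x hρ.1).ne']

theorem measurable_measure_inter_ball [BorelSpace E] (hA : MeasurableSet A) (ρ : ℝ) :
    Measurable fun x => μ (A ∩ Metric.ball x ρ) := by
  have hset : MeasurableSet {p : E × E | p.2 ∈ A ∧ dist p.2 p.1 < ρ} :=
    (measurable_snd hA).inter <|
      measurableSet_lt (measurable_snd.dist measurable_fst) measurable_const
  exact measurable_measure_prodMk_left hset

theorem measurable_ballDensity [BorelSpace E] (hA : MeasurableSet A) (ρ : ℝ) :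
    Measurable fun x => ballDensity μ A x ρ := by
  have hball := measurable_measure_inter_ball (μ := μ) MeasurableSet.univ ρ
  simp only [Set.univ_inter] at hball
  exact (measurable_measure_inter_ball hA ρ).ennreal_toReal.div hball.ennreal_toReal

end ProperSpace

section Haar

variable [NormedSpace ℝ E] [FiniteDimensional ℝ E] [BorelSpace E] [μ.IsAddHaarMeasure]

theorem ballDensity_le_ballDensity_mul_of_convex (hA : Convex ℝ A) (hx : x ∈ A) {c : ℝ}
    (hc₀ : 0 < c) (hc₁ : c ≤ 1) (ρ : ℝ) : ballDensity μ A x ρ ≤ ballDensity μ A x (c * ρ) := by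
  have hsub : AffineMap.homothety x c '' (A ∩ Metric.ball x ρ) ⊆ A ∩ Metric.ball x (c * ρ) := by
    rintro _ ⟨z, ⟨hzA, hz⟩, rfl⟩
    refine ⟨hA.lineMap_mem hx hzA ⟨hc₀.le, hc₁⟩, ?_⟩
    rw [Metric.mem_ball, dist_homothety_center, dist_comm, Real.norm_of_nonneg hc₀.le]
    exact mul_lt_mul_of_pos_left hz hc₀
  have hinter : c ^ Module.finrank ℝ E * μ.real (A ∩ Metric.ball x ρ)
      ≤ μ.real (A ∩ Metric.ball x (c * ρ)) := by
    have := measureReal_mono (μ := μ) hsub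
      (measure_ne_top_of_subset Set.inter_subset_right measure_ball_lt_top.ne)
    rwa [measureReal_def, Measure.addHaar_image_homothety, ENNReal.toReal_mul,
      ENNReal.toReal_ofReal (abs_nonneg _), abs_of_nonneg (by positivity)] at this
  have hball : μ.real (Metric.ball x (c * ρ))
      = c ^ Module.finrank ℝ E * μ.real (Metric.ball x ρ) := by
    rw [measureReal_def, Measure.addHaar_ball_mul_of_pos _ _ hc₀, ENNReal.toReal_mul,
      ENNReal.toReal_ofReal (by positivity), ← Measure.addHaar_ball_center μ x, measureReal_def]
  calc ballDensity μ A x ρ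
      = c ^ Module.finrank ℝ E * μ.real (A ∩ Metric.ball x ρ)
        / (c ^ Module.finrank ℝ E * μ.real (Metric.ball x ρ)) :=
        (mul_div_mul_left _ _ (by positivity)).symm
    _ ≤ μ.real (A ∩ Metric.ball x (c * ρ)) / μ.real (Metric.ball x (c * ρ)) := by
        rw [hball]
        gcongr

theorem antitoneOn_ballDensity_of_convex (hA : Convex ℝ A) (hx : x ∈ A) :
    AntitoneOn (ballDensity μ A x) (Set.Ioi 0) := by
  intro ρ hρ σ hσ hρσ
  have := ballDensity_le_ballDensity_mul_of_convex (μ := μ) hA hx (div_pos hρ hσ)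
    ((div_le_one hσ).2 hρσ) σ
  rwa [div_mul_cancel₀ _ (ne_of_gt hσ)] at this

variable (μ x) in
theorem exists_tendsto_ballDensity_of_convex (hA : Convex ℝ A) (hA' : IsClosed A) :
    ∃ c, Tendsto (ballDensity μ A x) (𝓝[>] 0) (𝓝 c) := by
  by_cases hx : x ∈ A
  · exact ⟨_, (antitoneOn_ballDensity_of_convex hA hx).tendsto_nhdsGT
      ⟨1, by rintro _ ⟨ρ, -, rfl⟩; exact ballDensity_le_one μ A x ρ⟩⟩
  · exact ⟨0, tendsto_ballDensity_of_notMem_closure (by rwa [hA'.closure_eq])⟩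

end Haar

end BallDensity

@[simp] theorem site_apply (i : Lattice) (k : Fin 2) : site i k = i k := rfl

theorem site_add (i j : Lattice) : site (i + j) = site i + site j := by ext; simp

theorem site_neg (i : Lattice) : site (-i) = -site i := by ext; simp

theorem site_sub (i j : Lattice) : site (i - j) = site i - site j := by ext; simp

theorem site_injective : Function.Injective site := fun i j h =>
  funext fun k => by simpa using congrArg (fun x : Plane => x k) h

theorem finite_setOf_site_mem {Ω : Set Plane} (hΩ : Bornology.IsBounded Ω) :
    {i | site i ∈ Ω}.Finite :=
  ((bonds_finite hΩ {0}).image Prod.fst).subset fun i hi => ⟨(i, 0), by simpa [bonds] using hi, rfl⟩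

theorem finite_setOf_site_add_mem {K W : Set Plane} (hK : Bornology.IsBounded K)
    (hW : Bornology.IsBounded W) : {i | ∃ w ∈ W, site i + w ∈ K}.Finite := by
  refine (finite_setOf_site_mem (hK.sub hW)).subset ?_
  rintro i ⟨w, hw, hi⟩
  exact ⟨_, hi, w, hw, add_sub_cancel_right _ _⟩

section LatticeSum

variable {M : Type*} [AddCommMonoid M] [TopologicalSpace M]

/-- The periodization of `f`: the sum of its values over the translate `ℤ² + w` of the lattice. -/
noncomputable def latticeSum (f : Plane → M) (w : Plane) : M :=
  ∑' i : Lattice, f (site i + w)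

theorem latticeSum_site_add (f : Plane → M) (j : Lattice) (w : Plane) :
    latticeSum f (site j + w) = latticeSum f w := by
  simp only [latticeSum, ← add_assoc, ← site_add]
  exact (Equiv.addRight j).tsum_eq fun i => f (site i + w)

theorem latticeSum_comp_neg (f : Plane → M) (w : Plane) :
    latticeSum (fun x => f (-x)) w = latticeSum f (-w) := by
  simp only [latticeSum, neg_add, ← site_neg]
  exact (Equiv.neg Lattice).tsum_eq fun i => f (site i + -w)

end LatticeSum

theorem setLIntegral_latticeSum_indicator {A : Set Plane} (hA : MeasurableSet A) (B : Set Plane) :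
    ∫⁻ z in B, latticeSum (A.indicator (1 : Plane → ℝ≥0∞)) z
      = ∑' i : Lattice, volume ((site i + ·) ⁻¹' A ∩ B) := by
  have hmeas : ∀ i : Lattice, Measurable fun z => A.indicator (1 : Plane → ℝ≥0∞) (site i + z) :=
    fun i => (measurable_one.indicator hA).comp (measurable_const_add _)
  refine (lintegral_tsum fun i => (hmeas i).aemeasurable).trans (tsum_congr fun i => ?_)
  have hpre : MeasurableSet ((site i + ·) ⁻¹' A) := measurable_const_add _ hA
  rw [← Measure.restrict_apply hpre]
  exact lintegral_indicator_one hpre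

theorem setLIntegral_latticeSum_indicator_comm {A B : Set Plane} (hA : MeasurableSet A)
    (hB : MeasurableSet B) :
    ∫⁻ z in B, latticeSum (A.indicator (1 : Plane → ℝ≥0∞)) z
      = ∫⁻ z in A, latticeSum (B.indicator (1 : Plane → ℝ≥0∞)) z := by
  rw [setLIntegral_latticeSum_indicator hA, setLIntegral_latticeSum_indicator hB,
    ← (Equiv.neg Lattice).tsum_eq]
  refine tsum_congr fun i => ?_
  rw [← measure_preimage_add volume (site i)]
  congr 1
  ext z
  simp [site_neg, and_comm]

theorem latticeSum_volume_inter_ball {A : Set Plane} (hA : MeasurableSet A) (ρ : ℝ) (w : Plane) :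
    latticeSum (fun x => volume (A ∩ Metric.ball x ρ)) w
      = ∫⁻ z in Metric.ball w ρ, latticeSum (A.indicator (1 : Plane → ℝ≥0∞)) z := by
  rw [setLIntegral_latticeSum_indicator hA]
  refine tsum_congr fun i => ?_
  beta_reduce
  rw [← measure_preimage_add volume (site i) (A ∩ Metric.ball (site i + w) ρ), Set.preimage_inter,
    preimage_add_ball, add_sub_cancel_left]

section FundamentalDomain

open Module Submodule ZSpan

variable {ι : Type*} {b : Basis ι ℝ Plane}

theorem span_le_range_site (hb : ∀ k, b k ∈ Set.range site) {x : Plane}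
    (hx : x ∈ span ℤ (Set.range b)) : x ∈ Set.range site := by
  have hle : span ℤ (Set.range b) ≤ (AddMonoidHom.mk' site site_add).range.toIntSubmodule :=
    span_le.2 (Set.range_subset_iff.2 hb)
  exact hle hx

theorem bijOn_fract_site [Fintype ι] (hb : ∀ k, b k ∈ Set.range site) (z : Plane) :
    Set.BijOn (fun i => fract b (site i)) {i | site i + z ∈ fundamentalDomain b}
      (Set.range fun i => fract b (site i)) := by
  refine ⟨fun i _ => Set.mem_range_self i, fun i hi j hj hij => ?_, ?_⟩
  · have h : fract b (site i + z) = fract b (site j + z) := by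
      have hsub : -(site i + z) + (site j + z) = -site i + site j := by abel
      rw [fract_eq_fract, hsub, ← fract_eq_fract]
      exact hij
    rw [fract_eq_self.2 hi, fract_eq_self.2 hj] at h
    exact site_injective (add_right_cancel h)
  · rintro _ ⟨i, rfl⟩
    obtain ⟨l, hl⟩ := span_le_range_site hb (ZSpan.floor b (site i + z)).2
    refine ⟨i - l, ?_, ?_⟩
    · have := fract_mem_fundamentalDomain b (site i + z)
      rwa [fract_apply, ← hl, add_sub_right_comm, ← site_sub] at this
    · refine (fract_eq_fract b _ _).2 ?_
      rw [site_sub, neg_sub, sub_add_cancel, hl]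
      exact (ZSpan.floor b (site i + z)).2

theorem latticeSum_indicator_fundamentalDomain_eq_encard [Fintype ι]
    (hb : ∀ k, b k ∈ Set.range site) (z : Plane) :
    latticeSum ((fundamentalDomain b).indicator (1 : Plane → ℝ≥0∞)) z
      = (Set.range fun i => fract b (site i)).encard := by
  set S : Set Lattice := {i | site i + z ∈ fundamentalDomain b}
  have hbij := bijOn_fract_site hb z
  calc latticeSum ((fundamentalDomain b).indicator (1 : Plane → ℝ≥0∞)) z
      = ∑' i : S, 1 := (tsum_subtype S 1).symm
    _ = S.encard := ENNReal.tsum_set_one S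
    _ = (Set.range fun i => fract b (site i)).encard := by
      rw [← hbij.image_eq, hbij.injOn.encard_image]

/-- The half-open unit square. -/
def unitSquare : Set Plane :=
  fundamentalDomain (EuclideanSpace.basisFun (Fin 2) ℝ).toBasis

theorem basisFun_mem_range_site (k : Fin 2) :
    (EuclideanSpace.basisFun (Fin 2) ℝ).toBasis k ∈ Set.range site :=
  ⟨Pi.single k 1, by ext j; by_cases h : j = k <;> simp [h]⟩

theorem volume_unitSquare : volume unitSquare = 1 := by
  rw [unitSquare, measure_congr (fundamentalDomain_ae_parallelepiped _ volume),
    OrthonormalBasis.coe_toBasis, OrthonormalBasis.volume_parallelepiped]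

theorem latticeSum_indicator_unitSquare (z : Plane) :
    latticeSum (unitSquare.indicator (1 : Plane → ℝ≥0∞)) z = 1 := by
  have hfract : ∀ i : Lattice, fract (EuclideanSpace.basisFun (Fin 2) ℝ).toBasis (site i) = 0 :=
    fun i => Basis.ext_elem _ fun k => by rw [repr_fract_apply]; simp
  rw [unitSquare, latticeSum_indicator_fundamentalDomain_eq_encard basisFun_mem_range_site]
  simp [hfract]

/-- The number of lattice points does not depend on the translate, so that it is the area follows by
averaging over the unit square, which contains exactly one point of every translate. -/
theorem latticeSum_indicator_fundamentalDomain [Finite ι] (hb : ∀ k, b k ∈ Set.range site)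
    (z : Plane) :
    latticeSum ((fundamentalDomain b).indicator (1 : Plane → ℝ≥0∞)) z
      = volume (fundamentalDomain b) := by
  cases nonempty_fintype ι
  have h := setLIntegral_latticeSum_indicator_comm (fundamentalDomain_measurableSet b)
    (fundamentalDomain_measurableSet (EuclideanSpace.basisFun (Fin 2) ℝ).toBasis)
  change ∫⁻ z in unitSquare, _ = ∫⁻ z in _, latticeSum (unitSquare.indicator 1) z at h
  simpa only [latticeSum_indicator_unitSquare, latticeSum_indicator_fundamentalDomain_eq_encard hb,
    setLIntegral_const, volume_unitSquare, mul_one, one_mul] using h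

end FundamentalDomain

section Coord

theorem basisOf_coord_eq_linear {ι V : Type*} [NormedAddCommGroup V] [NormedSpace ℝ V]
    (β : AffineBasis ι ℝ V) (i : ι) (j : {j // j ≠ i}) :
    (β.basisOf i).coord j = (β.coord j).linear := by
  classical
  refine (β.basisOf i).ext fun k => ?_
  rw [Module.Basis.coord_apply, Module.Basis.repr_self, β.basisOf_apply, AffineMap.linearMap_vsub,
    β.coord_apply, β.coord_apply_ne j.2]
  simp [Finsupp.single_apply, eq_comm, Subtype.ext_iff]

theorem addHaar_setOf_coord_eq {ι V : Type*} [Nontrivial ι] [NormedAddCommGroup V] [NormedSpace ℝ V]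
    [FiniteDimensional ℝ V] [MeasurableSpace V] [BorelSpace V] (μ : Measure V) [μ.IsAddHaarMeasure]
    (β : AffineBasis ι ℝ V) (i : ι) (c : ℝ) : μ {x | β.coord i x = c} = 0 := by
  have hset : {x | β.coord i x = c} = ((affineSpan ℝ {c}).comap (β.coord i) : Set V) := by
    ext x; simp
  rw [hset]
  refine Measure.addHaar_affineSubspace μ _ fun htop => ?_
  obtain ⟨x, hx⟩ := β.surjective_coord i (c + 1)
  have : x ∈ (affineSpan ℝ {c}).comap (β.coord i) := htop ▸ AffineSubspace.mem_top ℝ V x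
  simp [hx] at this

end Coord

section Triangle

open ZSpan

variable (β : AffineBasis (Fin 3) ℝ Plane)

theorem mem_convexHull_iff_coord {x : Plane} : x ∈ convexHull ℝ (Set.range β) ↔
    0 ≤ β.coord 0 x ∧ 0 ≤ β.coord 1 x ∧ 0 ≤ β.coord 2 x := by
  rw [β.convexHull_eq_nonneg_coord]
  simp [Fin.forall_fin_succ]

theorem coord_pointReflection (j : Fin 3) (x : Plane) :
    β.coord j (β 1 + β 2 - x) = β.coord j (β 1) + β.coord j (β 2) - β.coord j x := by
  have : β 1 + β 2 - x = (β 1 -ᵥ x) +ᵥ β 2 := by rw [vsub_eq_sub, vadd_eq_add]; abel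
  rw [this, AffineMap.map_vadd, AffineMap.linearMap_vsub]
  simp only [vsub_eq_sub, vadd_eq_add]
  ring

theorem sub_mem_fundamentalDomain_iff_coord {x : Plane} :
    x - β 0 ∈ fundamentalDomain (β.basisOf 0) ↔
      β.coord 1 x ∈ Set.Ico 0 1 ∧ β.coord 2 x ∈ Set.Ico 0 1 := by
  have hrepr : ∀ j : {j : Fin 3 // j ≠ 0}, (β.basisOf 0).repr (x - β 0) j = β.coord j x := by
    intro j
    rw [← Module.Basis.coord_apply, basisOf_coord_eq_linear, ← vsub_eq_sub,
      AffineMap.linearMap_vsub, β.coord_apply_ne j.2, vsub_eq_sub, sub_zero]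
  simp only [mem_fundamentalDomain, hrepr]
  simp [Fin.forall_fin_succ]

theorem indicator_fundamentalDomain_ae_eq : ∀ᵐ x,
    (fundamentalDomain (β.basisOf 0)).indicator (1 : Plane → ℝ≥0∞) (x - β 0)
      = (convexHull ℝ (Set.range β)).indicator 1 x
        + (convexHull ℝ (Set.range β)).indicator 1 (β 1 + β 2 - x) := by
  have hne : ∀ i c, ∀ᵐ x, β.coord i x ≠ c := fun i c =>
    measure_eq_zero_iff_ae_notMem.1 (addHaar_setOf_coord_eq volume β i c)
  filter_upwards [hne 0 0, hne 1 1, hne 2 1] with x h0 h1 h2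
  have hsum : β.coord 0 x + β.coord 1 x + β.coord 2 x = 1 := by
    rw [← Fin.sum_univ_three fun i => β.coord i x]
    exact β.sum_coord_apply_eq_one x
  have hlt1 : β.coord 1 x ≤ 1 ↔ β.coord 1 x < 1 := h1.le_iff_lt
  have hlt2 : β.coord 2 x ≤ 1 ↔ β.coord 2 x < 1 := h2.le_iff_lt
  have hP := sub_mem_fundamentalDomain_iff_coord β (x := x)
  have hT := mem_convexHull_iff_coord β (x := x)
  have hT' : β 1 + β 2 - x ∈ convexHull ℝ (Set.range β) ↔
      β.coord 0 x ≤ 0 ∧ β.coord 1 x ≤ 1 ∧ β.coord 2 x ≤ 1 := by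
    simp [mem_convexHull_iff_coord, coord_pointReflection, β.coord_apply]
  simp only [Set.mem_Ico, ← hlt1, ← hlt2] at hP
  generalize β.coord 0 x = c₀, β.coord 1 x = c₁, β.coord 2 x = c₂ at *
  rcases h0.lt_or_gt with hneg | hpos
  · have hxT : x ∉ convexHull ℝ (Set.range β) := fun h => hneg.not_ge (hT.1 h).1
    have hiff : x - β 0 ∈ fundamentalDomain (β.basisOf 0) ↔
        β 1 + β 2 - x ∈ convexHull ℝ (Set.range β) := by
      rw [hP, hT']
      grind
    rw [Set.indicator_of_notMem hxT, zero_add]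
    exact Set.indicator_eq_indicator hiff rfl
  · have hxT' : β 1 + β 2 - x ∉ convexHull ℝ (Set.range β) := fun h => hpos.not_ge (hT'.1 h).1
    have hiff : x - β 0 ∈ fundamentalDomain (β.basisOf 0) ↔ x ∈ convexHull ℝ (Set.range β) := by
      rw [hP, hT]
      grind
    rw [Set.indicator_of_notMem hxT', add_zero]
    exact Set.indicator_eq_indicator hiff rfl

theorem volume_fundamentalDomain_basisOf :
    volume (fundamentalDomain (β.basisOf 0)) = 2 * volume (convexHull ℝ (Set.range β)) := by
  have hT : MeasurableSet (convexHull ℝ (Set.range β)) :=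
    (Set.finite_range β).isClosed_convexHull ℝ |>.measurableSet
  calc volume (fundamentalDomain (β.basisOf 0))
      = ∫⁻ x, (fundamentalDomain (β.basisOf 0)).indicator 1 (x - β 0) := by
        rw [lintegral_sub_right_eq_self,
          lintegral_indicator_one (fundamentalDomain_measurableSet _)]
    _ = ∫⁻ x, ((convexHull ℝ (Set.range β)).indicator 1 x
          + (convexHull ℝ (Set.range β)).indicator 1 (β 1 + β 2 - x)) :=
        lintegral_congr_ae (indicator_fundamentalDomain_ae_eq β)
    _ = 2 * volume (convexHull ℝ (Set.range β)) := by
        rw [lintegral_add_left (measurable_one.indicator hT), lintegral_sub_left_eq_self,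
          lintegral_indicator_one hT, two_mul]

theorem latticeSum_indicator_triangle_ae_eq (hβ : ∀ j, β j ∈ Set.range site) : ∀ᵐ z,
    latticeSum ((convexHull ℝ (Set.range β)).indicator (1 : Plane → ℝ≥0∞)) z
        + latticeSum ((convexHull ℝ (Set.range β)).indicator 1) (-z)
      = 2 * volume (convexHull ℝ (Set.range β)) := by
  choose v hv using hβ
  have hedge : ∀ j : {j : Fin 3 // j ≠ 0}, β.basisOf 0 j ∈ Set.range site := fun j =>
    ⟨v j - v 0, by rw [site_sub, hv, hv, β.basisOf_apply, vsub_eq_sub]⟩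
  have htranslates : ∀ᵐ z, ∀ i : Lattice,
      (fundamentalDomain (β.basisOf 0)).indicator (1 : Plane → ℝ≥0∞) (site i + z - β 0)
        = (convexHull ℝ (Set.range β)).indicator 1 (site i + z)
          + (convexHull ℝ (Set.range β)).indicator 1 (β 1 + β 2 - (site i + z)) :=
    ae_all_iff.2 fun i => (measurePreserving_add_left volume (site i)).quasiMeasurePreserving.ae
      (indicator_fundamentalDomain_ae_eq β)
  filter_upwards [htranslates] with z hz
  set f : Plane → ℝ≥0∞ := (convexHull ℝ (Set.range β)).indicator 1
  have hrefl : latticeSum f (-z) = ∑' i, f (β 1 + β 2 - (site i + z)) := by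
    rw [← latticeSum_site_add f (v 1 + v 2), site_add, hv, hv, ← sub_eq_add_neg,
      ← neg_sub, ← latticeSum_comp_neg]
    refine tsum_congr fun i => congrArg f ?_
    abel
  calc latticeSum f z + latticeSum f (-z)
      = ∑' i, (f (site i + z) + f (β 1 + β 2 - (site i + z))) := by
        rw [ENNReal.tsum_add, hrefl, latticeSum]
    _ = latticeSum ((fundamentalDomain (β.basisOf 0)).indicator 1) (z - β 0) := by
        simp only [← hz, latticeSum, ← add_sub_assoc]
    _ = 2 * volume (convexHull ℝ (Set.range β)) := by
        rw [latticeSum_indicator_fundamentalDomain hedge, volume_fundamentalDomain_basisOf]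

end Triangle

section Density

theorem chi_eq_of_tendsto {A : Set Plane} {x : Plane} {c : ℝ}
    (h : Tendsto (ballDensity volume A x) (𝓝[>] 0) (𝓝 c)) : chi A x = c :=
  h.limUnder_eq

theorem chi_eq_one_of_mem_nhds {A : Set Plane} {x : Plane} (h : A ∈ 𝓝 x) : chi A x = 1 :=
  chi_eq_of_tendsto (tendsto_ballDensity_of_mem_nhds h)

theorem chi_eq_zero_of_notMem_closure {A : Set Plane} {x : Plane} (h : x ∉ closure A) :
    chi A x = 0 :=
  chi_eq_of_tendsto (tendsto_ballDensity_of_notMem_closure h)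

theorem isCompact_tri (T : Finset Lattice) : IsCompact (tri T) :=
  (T.finite_toSet.image site).isCompact_convexHull ℝ

theorem convex_tri (T : Finset Lattice) : Convex ℝ (tri T) := convex_convexHull ℝ _

theorem isClosed_tri (T : Finset Lattice) : IsClosed (tri T) := (isCompact_tri T).isClosed

theorem tendsto_ballDensity_tri (T : Finset Lattice) (x : Plane) :
    Tendsto (ballDensity volume (tri T) x) (𝓝[>] 0) (𝓝 (chi (tri T) x)) := by
  obtain ⟨c, hc⟩ := exists_tendsto_ballDensity_of_convex volume x (convex_tri T) (isClosed_tri T)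
  rwa [chi_eq_of_tendsto hc]

theorem chi_tri_nonneg (T : Finset Lattice) (x : Plane) : 0 ≤ chi (tri T) x :=
  ge_of_tendsto' (tendsto_ballDensity_tri T x) fun _ => ballDensity_nonneg _ _ _ _

theorem chi_tri_le_one (T : Finset Lattice) (x : Plane) : chi (tri T) x ≤ 1 :=
  le_of_tendsto' (tendsto_ballDensity_tri T x) fun _ => ballDensity_le_one _ _ _ _

theorem chi_tri_eq_zero {T : Finset Lattice} {x : Plane} (h : x ∉ tri T) : chi (tri T) x = 0 :=
  chi_eq_zero_of_notMem_closure ((isClosed_tri T).closure_eq.symm ▸ h)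

theorem measurable_chi_tri (T : Finset Lattice) : Measurable (chi (tri T)) :=
  measurable_of_tendsto_metrizable' (𝓝[>] (0 : ℝ))
    (fun ρ => measurable_ballDensity (isClosed_tri T).measurableSet ρ)
    (tendsto_pi_nhds.2 fun x => tendsto_ballDensity_tri T x)

theorem bondPoint_eq (b : Lattice × Lattice) (t : ℝ) :
    bondPoint b t = site b.1 + t • site b.2 := by
  rw [bondPoint, site_add]
  module

theorem continuous_bondPoint (b : Lattice × Lattice) : Continuous (bondPoint b) := by
  unfold bondPoint
  fun_prop

theorem intervalIntegrable_chi_tri (T : Finset Lattice) (b : Lattice × Lattice) :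
    IntervalIntegrable (fun t => chi (tri T) (bondPoint b t)) volume 0 1 := by
  refine (intervalIntegrable_const (c := (1 : ℝ))).mono_fun ((measurable_chi_tri T).comp
    (continuous_bondPoint b).measurable).aestronglyMeasurable (ae_of_all _ fun t => ?_)
  simpa only [Real.norm_of_nonneg (chi_tri_nonneg _ _), norm_one] using chi_tri_le_one _ _

end Density

section LatticeTriangle

variable {T : Finset Lattice}

/-- The vertices of a non-degenerate triangle as an affine basis of the plane. -/
noncomputable def vertexBasis (hcard : T.card = 3)
    (hindep : AffineIndependent ℝ fun v : T => site v) : AffineBasis T ℝ Plane where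
  toFun v := site v
  ind' := hindep
  tot' := hindep.affineSpan_eq_top_iff_card_eq_finrank_add_one.2 (by simp [hcard])

@[simp] theorem vertexBasis_apply (hcard : T.card = 3)
    (hindep : AffineIndependent ℝ fun v : T => site v) (v : T) :
    vertexBasis hcard hindep v = site v := rfl

theorem tri_eq_convexHull_range_vertexBasis (hcard : T.card = 3)
    (hindep : AffineIndependent ℝ fun v : T => site v) :
    tri T = convexHull ℝ (Set.range (vertexBasis hcard hindep)) := by
  rw [tri, Set.image_eq_range]
  rfl

theorem barycenter_mem_interior_tri (hcard : T.card = 3)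
    (hindep : AffineIndependent ℝ fun v : T => site v) : barycenter T ∈ interior (tri T) := by
  have hcentroid : barycenter T = Finset.univ.centroid ℝ (vertexBasis hcard hindep) := by
    rw [Finset.centroid_def, Finset.affineCombination_eq_linear_combination _ _ _
      (Finset.univ.sum_centroidWeights_eq_one_of_card_ne_zero ℝ (by simp [hcard]))]
    simp only [barycenter, Finset.centroidWeights_apply, Finset.card_univ, Fintype.card_coe, hcard,
      Nat.cast_ofNat, vertexBasis_apply, ← Finset.smul_sum]
    rw [Finset.sum_coe_sort T site]
  rw [hcentroid, tri_eq_convexHull_range_vertexBasis hcard hindep]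
  exact (vertexBasis hcard hindep).centroid_mem_interior_convexHull

theorem latticeSum_indicator_tri_ae_eq (hcard : T.card = 3)
    (hindep : AffineIndependent ℝ fun v : T => site v) : ∀ᵐ z,
    latticeSum ((tri T).indicator (1 : Plane → ℝ≥0∞)) z + latticeSum ((tri T).indicator 1) (-z)
      = 2 * volume (tri T) := by
  let β := (vertexBasis hcard hindep).reindex (T.equivFinOfCardEq hcard)
  have hβ : tri T = convexHull ℝ (Set.range β) := by
    rw [tri_eq_convexHull_range_vertexBasis hcard hindep, AffineBasis.coe_reindex,
      EquivLike.range_comp]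
  rw [hβ]
  exact latticeSum_indicator_triangle_ae_eq β fun j => ⟨_, rfl⟩

theorem latticeSum_volume_tri_inter_ball (hcard : T.card = 3)
    (hindep : AffineIndependent ℝ fun v : T => site v) (w : Plane) (ρ : ℝ) :
    latticeSum (fun x => volume (tri T ∩ Metric.ball x ρ)) w
        + latticeSum (fun x => volume (tri T ∩ Metric.ball x ρ)) (-w)
      = 2 * volume (tri T) * volume (Metric.ball (0 : Plane) ρ) := by
  have hT : MeasurableSet (tri T) := (isClosed_tri T).measurableSet
  set S : Plane → ℝ≥0∞ := latticeSum ((tri T).indicator 1)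
  have hS : Measurable S := Measurable.tsum fun i =>
    (measurable_one.indicator hT).comp (measurable_const_add _)
  have hrefl : ∫⁻ z in Metric.ball (-w) ρ, S z = ∫⁻ z in Metric.ball w ρ, S (-z) := by
    rw [← (Measure.measurePreserving_neg (volume : Measure Plane)).setLIntegral_comp_preimage
      measurableSet_ball hS]
    simp
  rw [latticeSum_volume_inter_ball hT, latticeSum_volume_inter_ball hT, hrefl,
    ← lintegral_add_left hS, lintegral_congr_ae
      (ae_restrict_of_ae (latticeSum_indicator_tri_ae_eq hcard hindep)),
    setLIntegral_const, Measure.addHaar_ball_center]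

theorem latticeSum_ballDensity_tri (hcard : T.card = 3)
    (hindep : AffineIndependent ℝ fun v : T => site v) (w : Plane) {ρ : ℝ} (hρ : 0 < ρ) :
    latticeSum (fun x => ballDensity volume (tri T) x ρ) w
        + latticeSum (fun x => ballDensity volume (tri T) x ρ) (-w)
      = 2 * volume.real (tri T) := by
  have hreal : ∀ w, latticeSum (fun x => ballDensity volume (tri T) x ρ) w
      = (latticeSum (fun x => volume (tri T ∩ Metric.ball x ρ)) w).toReal
        / volume.real (Metric.ball (0 : Plane) ρ) := by
    intro w
    have hfin : ∀ i, volume (tri T ∩ Metric.ball (site i + w) ρ) ≠ ⊤ := fun i =>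
      measure_ne_top_of_subset Set.inter_subset_right measure_ball_lt_top.ne
    rw [latticeSum, latticeSum, ENNReal.tsum_toReal_eq hfin, ← tsum_div_const]
    simp only [ballDensity, measureReal_def, Measure.addHaar_ball_center]
  have hsum := latticeSum_volume_tri_inter_ball hcard hindep w ρ
  have hfin : 2 * volume (tri T) * volume (Metric.ball (0 : Plane) ρ) ≠ ⊤ :=
    ENNReal.mul_ne_top (ENNReal.mul_ne_top (by simp) (isCompact_tri T).measure_lt_top.ne)
      measure_ball_lt_top.ne
  obtain ⟨hfin₁, hfin₂⟩ := ENNReal.add_ne_top.1 (hsum ▸ hfin)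
  rw [hreal, hreal, ← add_div, ← ENNReal.toReal_add hfin₁ hfin₂, hsum, ENNReal.toReal_mul,
    ENNReal.toReal_mul, ← measureReal_def, ← measureReal_def,
    mul_div_cancel_right₀ _ (measureReal_ball_pos 0 hρ).ne', ENNReal.toReal_ofNat]

theorem tendsto_latticeSum_ballDensity_tri (T : Finset Lattice) (w : Plane) :
    Tendsto (fun ρ => latticeSum (fun x => ballDensity volume (tri T) x ρ) w) (𝓝[>] 0)
      (𝓝 (latticeSum (chi (tri T)) w)) := by
  let I : Set Lattice := {i | ∃ v ∈ Metric.ball w 1, site i + v ∈ tri T}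
  have hI : I.Finite := finite_setOf_site_add_mem (isCompact_tri T).isBounded Metric.isBounded_ball
  have hbound : Summable (I.indicator (1 : Lattice → ℝ)) :=
    summable_of_hasFiniteSupport (hI.subset Set.support_indicator_subset)
  refine tendsto_tsum_of_dominated_convergence hbound (fun i => tendsto_ballDensity_tri T _) ?_
  filter_upwards [Ioo_mem_nhdsGT one_pos] with ρ hρ i
  by_cases hi : i ∈ I
  · simpa [hi, Real.norm_of_nonneg (ballDensity_nonneg _ _ _ _)] using ballDensity_le_one _ _ _ _
  · have hempty : tri T ∩ Metric.ball (site i + w) ρ = ∅ := by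
      refine Set.eq_empty_of_forall_notMem fun z ⟨hzT, hz⟩ => hi ⟨z - site i, ?_, by simpa⟩
      rw [Metric.mem_ball, dist_eq_norm] at hz ⊢
      rw [sub_sub]
      exact hz.trans hρ.2
    simp [hi, ballDensity, hempty]

theorem latticeSum_chi_tri_add_latticeSum_chi_tri_neg (hcard : T.card = 3)
    (hindep : AffineIndependent ℝ fun v : T => site v) (w : Plane) :
    latticeSum (chi (tri T)) w + latticeSum (chi (tri T)) (-w) = 2 * volume.real (tri T) := by
  have hlim := (tendsto_latticeSum_ballDensity_tri T w).add
    (tendsto_latticeSum_ballDensity_tri T (-w))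
  refine tendsto_nhds_unique hlim (tendsto_const_nhds.congr' ?_)
  filter_upwards [self_mem_nhdsWithin] with ρ hρ
  exact (latticeSum_ballDensity_tri hcard hindep w hρ).symm

theorem finite_setOf_chi_tri_bondPoint_ne_zero (T : Finset Lattice) (r : Lattice) :
    {i | ∃ t ∈ Set.Icc (0 : ℝ) 1, chi (tri T) (bondPoint (i, r) t) ≠ 0}.Finite := by
  have hbond : Bornology.IsBounded ((· • site r) '' Set.Icc (0 : ℝ) 1) :=
    (isCompact_Icc.image (by fun_prop)).isBounded
  refine (finite_setOf_site_add_mem (isCompact_tri T).isBounded hbond).subset ?_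
  rintro i ⟨t, ht, hi⟩
  rw [bondPoint_eq] at hi
  exact ⟨_, ⟨t, ht, rfl⟩, by_contra fun h => hi (chi_tri_eq_zero h)⟩

theorem intervalIntegral_eq_of_add_comp_one_sub_eq {S : ℝ → ℝ} {c : ℝ}
    (hint : IntervalIntegrable S volume 0 1) (hS : ∀ t, S t + S (1 - t) = 2 * c) :
    ∫ t in (0 : ℝ)..1, S t = c := by
  have hsymm : ∫ t in (0 : ℝ)..1, S (1 - t) = ∫ t in (0 : ℝ)..1, S t := by
    rw [intervalIntegral.integral_comp_sub_left S, sub_self, sub_zero]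
  have hint' : IntervalIntegrable (fun t => S (1 - t)) volume 0 1 := by
    simpa only [sub_zero, sub_self] using (hint.comp_sub_left 1).symm
  have htwice := intervalIntegral.integral_add hint hint'
  simp only [hS, hsymm, intervalIntegral.integral_const, sub_zero, one_smul] at htwice
  linarith

theorem hasSum_bondAverage_chi_tri (hcard : T.card = 3)
    (hindep : AffineIndependent ℝ fun v : T => site v) (r : Lattice) :
    HasSum (fun i => bondAverage (i, r) (chi (tri T))) (volume.real (tri T)) := by
  let I := (finite_setOf_chi_tri_bondPoint_ne_zero T r).toFinset
  have hzero : ∀ i ∉ I, ∀ t ∈ Set.uIcc (0 : ℝ) 1, chi (tri T) (bondPoint (i, r) t) = 0 := by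
    intro i hi t ht
    rw [Set.uIcc_of_le zero_le_one] at ht
    by_contra h
    exact hi ((Set.Finite.mem_toFinset _).2 ⟨t, ht, h⟩)
  have hsum : ∀ t ∈ Set.uIcc (0 : ℝ) 1, ∑ i ∈ I, chi (tri T) (bondPoint (i, r) t)
      = latticeSum (chi (tri T)) (t • site r) := fun t ht => by
    rw [latticeSum, tsum_eq_sum fun i hi => by simpa only [bondPoint_eq] using hzero i hi t ht]
    simp only [bondPoint_eq]
  have hint : IntervalIntegrable (fun t : ℝ => latticeSum (chi (tri T)) (t • site r)) volume 0 1 :=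
    (IntervalIntegrable.sum I fun i _ => intervalIntegrable_chi_tri T (i, r)).congr
      fun t ht => by simpa using hsum t (Set.uIoc_subset_uIcc ht)
  have hperiod : ∀ t : ℝ, latticeSum (chi (tri T)) (t • site r)
      + latticeSum (chi (tri T)) ((1 - t) • site r) = 2 * volume.real (tri T) := fun t => by
    rw [sub_smul, one_smul, sub_eq_add_neg, latticeSum_site_add,
      latticeSum_chi_tri_add_latticeSum_chi_tri_neg hcard hindep]
  rw [← intervalIntegral_eq_of_add_comp_one_sub_eq hint hperiod,
    ← intervalIntegral.integral_congr hsum,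
    intervalIntegral.integral_finsetSum fun i _ => intervalIntegrable_chi_tri T _]
  refine hasSum_sum_of_ne_finset_zero fun i hi => ?_
  rw [bondAverage, intervalIntegral.integral_congr (hzero i hi), intervalIntegral.integral_zero]

end LatticeTriangle

theorem interior_tri_ae_eq (T : Finset Lattice) : interior (tri T) =ᵐ[volume] tri T :=
  interior_ae_eq_of_null_frontier ((convex_tri T).addHaar_frontier volume)

theorem bondPoint_mem_seg (b : Lattice × Lattice) {t : ℝ} (ht : t ∈ Set.Ioo (0 : ℝ) 1) :
    bondPoint b t ∈ seg b :=
  ⟨1 - t, t, sub_pos.2 ht.2, ht.1, sub_add_cancel 1 t, rfl⟩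

theorem bondAverage_congr {b : Lattice × Lattice} {f g : Plane → ℝ} (h : Set.EqOn f g (seg b)) :
    bondAverage b f = bondAverage b g := by
  simp only [bondAverage, intervalIntegral.integral_of_le zero_le_one, integral_Ioc_eq_integral_Ioo]
  exact setIntegral_congr_fun measurableSet_Ioo fun t ht => h (bondPoint_mem_seg b ht)

theorem eventually_add_smul_mem {S : Set Plane} {x : Plane} (hx : S ∈ 𝓝 x) (v : Plane) :
    ∀ᶠ s : ℝ in 𝓝 0, x + s • v ∈ S := by
  have hcont : Continuous fun s : ℝ => x + s • v := by fun_prop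
  exact hcont.tendsto' 0 x (by simp) hx

theorem ae_eventually_add_smul_mem_of_convex {S : Set Plane} (hS : Convex ℝ S) (x v : Plane) :
    ∀ᵐ t : ℝ, x + t • v ∈ S → ∀ᶠ s : ℝ in 𝓝 0, x + t • v + s • v ∈ S := by
  let L : ℝ →ᵃ[ℝ] Plane := AffineMap.lineMap x (x + v)
  have hL : ∀ t, L t = x + t • v := fun t => by simp [L, AffineMap.lineMap_apply, add_comm]
  have hfrontier : volume (frontier (L ⁻¹' S)) = 0 := (hS.affine_preimage L).addHaar_frontier volume
  filter_upwards [measure_eq_zero_iff_ae_notMem.1 hfrontier] with t ht hmem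
  have hnhds : L ⁻¹' S ∈ 𝓝 t := by
    rw [← mem_interior_iff_mem_nhds]
    exact by_contra fun h => ht ⟨subset_closure (by rwa [Set.mem_preimage, hL]), h⟩
  have htranslate : Tendsto (fun s : ℝ => t + s) (𝓝 0) (𝓝 t) :=
    (continuous_const_add t).tendsto' 0 t (add_zero t)
  filter_upwards [htranslate hnhds] with s (hs : L (t + s) ∈ S)
  rwa [hL, add_smul, ← add_assoc] at hs

theorem dirDeriv_eq_linear {y : Plane → Plane} {A : Plane →ᵃ[ℝ] Plane} {S : Set Plane}
    (hA : Set.EqOn y A S) {r : Lattice} {x : Plane} (hx : ∀ᶠ s : ℝ in 𝓝 0, x + s • site r ∈ S) :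
    dirDeriv r y x = A.linear (site r) := by
  have hline : (fun s : ℝ => y (x + s • site r)) =ᶠ[𝓝 0] fun s => A x + s • A.linear (site r) := by
    filter_upwards [hx] with s hs
    rw [hA hs, add_comm x, ← vadd_eq_add, A.map_vadd, map_smul, vadd_eq_add, add_comm]
  have hderiv : HasDerivAt (fun s : ℝ => A x + s • A.linear (site r)) (A.linear (site r)) 0 := by
    simpa using ((hasDerivAt_id (0 : ℝ)).smul_const (A.linear (site r))).const_add (A x)
  rw [dirDeriv, lineDeriv, hline.deriv_eq, hderiv.deriv]

/-- The total share of the bonds in `B` of direction `r` that lies in the triangle `T`, the edges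
of `T` counting half. -/
noncomputable def coverage (B : Finset (Lattice × Lattice)) (T : Finset Lattice) (r : Lattice) :
    ℝ :=
  ∑ b ∈ B with b.2 = r, bondAverage b (chi (tri T))

theorem sum_bondAverage_chi_tri_mul {R : Finset Lattice} {B : Finset (Lattice × Lattice)}
    (hBR : ∀ b ∈ B, b.2 ∈ R) (T : Finset Lattice) (g : Lattice → ℝ) :
    ∑ b ∈ B, bondAverage b (chi (tri T)) * g b.2 = ∑ r ∈ R, coverage B T r * g r := by
  rw [← Finset.sum_fiberwise_of_maps_to hBR]
  refine Finset.sum_congr rfl fun r _ => ?_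
  rw [coverage, Finset.sum_mul]
  refine Finset.sum_congr rfl fun b hb => ?_
  rw [(Finset.mem_filter.1 hb).2]

namespace IsTriangulation

variable {𝒯 : Finset (Finset Lattice)} {ω : Set Plane} {T : Finset Lattice}

theorem isOpen (h : IsTriangulation 𝒯 ω) : IsOpen ω := h.region_eq ▸ isOpen_interior

theorem interior_tri_subset (h : IsTriangulation 𝒯 ω) (hT : T ∈ 𝒯) : interior (tri T) ⊆ ω := by
  rw [h.region_eq]
  exact interior_mono (Set.subset_biUnion_of_mem (u := tri) hT)

theorem ae_eq_biUnion_interior (h : IsTriangulation 𝒯 ω) :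
    ω =ᵐ[volume] (⋃ T ∈ 𝒯, interior (tri T) : Set Plane) := by
  have hsub : ω ⊆ ⋃ T ∈ 𝒯, tri T := by
    rw [h.region_eq]
    exact interior_subset
  have hunion : (⋃ T ∈ 𝒯, interior (tri T) : Set Plane) =ᵐ[volume] (⋃ T ∈ 𝒯, tri T : Set Plane) :=
    Filter.EventuallyEq.countable_bUnion 𝒯.countable_toSet fun T _ => interior_tri_ae_eq T
  have hsup : (⋃ T ∈ 𝒯, interior (tri T)) ⊆ ω :=
    Set.iUnion₂_subset fun T hT => h.interior_tri_subset hT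
  exact (hsub.eventuallyLE.trans hunion.symm.le).antisymm hsup.eventuallyLE

theorem ballDensity_eq_sum (h : IsTriangulation 𝒯 ω) (x : Plane) (ρ : ℝ) :
    ballDensity volume ω x ρ = ∑ T ∈ 𝒯, ballDensity volume (tri T) x ρ := by
  have hball : ∀ {s t : Set Plane}, s =ᵐ[volume] t →
      volume.real (s ∩ Metric.ball x ρ) = volume.real (t ∩ Metric.ball x ρ) := fun hst =>
    measureReal_congr (hst.inter ae_eq_rfl)
  simp only [ballDensity, ← Finset.sum_div]
  rw [hball h.ae_eq_biUnion_interior, Set.iUnion₂_inter, measureReal_biUnion_finset]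
  · simp only [hball (interior_tri_ae_eq _)]
  · exact fun T hT T' hT' hne => (h.nonoverlapping T hT T' hT' hne).mono
      Set.inter_subset_left Set.inter_subset_left
  · exact fun T _ => isOpen_interior.measurableSet.inter measurableSet_ball

theorem chi_eq_sum (h : IsTriangulation 𝒯 ω) (x : Plane) :
    chi ω x = ∑ T ∈ 𝒯, chi (tri T) x := by
  refine chi_eq_of_tendsto ?_
  rw [funext (h.ballDensity_eq_sum x)]
  exact tendsto_finsetSum _ fun T _ => tendsto_ballDensity_tri T x

theorem chi_tri_eq_zero_of_notMem_closure (h : IsTriangulation 𝒯 ω) (hT : T ∈ 𝒯) {x : Plane}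
    (hx : x ∉ closure ω) : chi (tri T) x = 0 := by
  have hsum := h.chi_eq_sum x
  rw [chi_eq_zero_of_notMem_closure hx] at hsum
  exact (Finset.sum_eq_zero_iff_of_nonneg fun T _ => chi_tri_nonneg T x).1 hsum.symm T hT

theorem bondAverage_chi_tri_eq_zero (h : IsTriangulation 𝒯 ω) (hT : T ∈ 𝒯)
    {b : Lattice × Lattice} (hb : ¬ (seg b ∩ closure ω).Nonempty) :
    bondAverage b (chi (tri T)) = 0 := by
  have hzero : Set.EqOn (chi (tri T)) 0 (seg b) := fun x hx =>
    h.chi_tri_eq_zero_of_notMem_closure hT fun hx' => hb ⟨x, hx, hx'⟩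
  rw [bondAverage_congr hzero, bondAverage]
  exact intervalIntegral.integral_zero

theorem coverage_eq_volume (h : IsTriangulation 𝒯 ω) (hT : T ∈ 𝒯) {r : Lattice}
    {B : Finset (Lattice × Lattice)}
    (hB : ∀ i : Lattice, (seg (i, r) ∩ closure ω).Nonempty → (i, r) ∈ B) :
    coverage B T r = volume.real (tri T) := by
  let I : Finset Lattice := {b ∈ B | b.2 = r}.image Prod.fst
  have hI : ∀ i ∉ I, bondAverage (i, r) (chi (tri T)) = 0 := fun i hi =>
    h.bondAverage_chi_tri_eq_zero hT fun hne => hi (Finset.mem_image.2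
      ⟨(i, r), Finset.mem_filter.2 ⟨hB i hne, rfl⟩, rfl⟩)
  have hsnd : ∀ b ∈ B.filter fun b => b.2 = r, b.2 = r := fun b hb => (Finset.mem_filter.1 hb).2
  rw [(hasSum_bondAverage_chi_tri (h.card_eq T hT) (h.nondegenerate T hT) r).unique
    (hasSum_sum_of_ne_finset_zero hI), Finset.sum_image fun b hb b' hb' hfst =>
      Prod.ext hfst ((hsnd b hb).trans (hsnd b' hb').symm)]
  exact Finset.sum_congr rfl fun b hb => by rw [← hsnd b hb]

section Deformation

variable {y : Plane → Plane}

theorem dirDeriv_eq_dirDeriv_barycenter (h : IsTriangulation 𝒯 ω) (hy : IsP1 𝒯 y) (hT : T ∈ 𝒯)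
    {r : Lattice} {x : Plane} (hx : ∀ᶠ s : ℝ in 𝓝 0, x + s • site r ∈ tri T) :
    dirDeriv r y x = dirDeriv r y (barycenter T) := by
  obtain ⟨A, hA⟩ := hy T hT
  have hbary := barycenter_mem_interior_tri (h.card_eq T hT) (h.nondegenerate T hT)
  rw [dirDeriv_eq_linear hA hx,
    dirDeriv_eq_linear hA (eventually_add_smul_mem (mem_interior_iff_mem_nhds.1 hbary) _)]

theorem contDensity_bondPoint_ae_eq (h : IsTriangulation 𝒯 ω) (hy : IsP1 𝒯 y) (φ : ℝ → ℝ)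
    (b : Lattice × Lattice) :
    (fun t => contDensity ω φ y b (bondPoint b t)) =ᵐ[volume] fun t => ∑ T ∈ 𝒯,
      chi (tri T) (bondPoint b t) * φ ‖dirDeriv b.2 y (barycenter T)‖ := by
  have hae : ∀ᵐ t : ℝ, ∀ T ∈ 𝒯, bondPoint b t ∈ tri T →
      ∀ᶠ s : ℝ in 𝓝 0, bondPoint b t + s • site b.2 ∈ tri T := by
    simp only [bondPoint_eq]
    exact (ae_ball_iff 𝒯.countable_toSet).2 fun T _ =>
      ae_eventually_add_smul_mem_of_convex (convex_tri T) _ _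
  filter_upwards [hae] with t ht
  rw [contDensity, h.chi_eq_sum, Finset.sum_mul]
  refine Finset.sum_congr rfl fun T hT => ?_
  by_cases hx : bondPoint b t ∈ tri T
  · rw [h.dirDeriv_eq_dirDeriv_barycenter hy hT (ht T hT hx)]
  · rw [chi_tri_eq_zero hx, zero_mul, zero_mul]

theorem intervalIntegrable_contDensity (h : IsTriangulation 𝒯 ω) (hy : IsP1 𝒯 y) (φ : ℝ → ℝ)
    (b : Lattice × Lattice) :
    IntervalIntegrable (fun t => contDensity ω φ y b (bondPoint b t)) volume 0 1 := by
  refine IntervalIntegrable.congr_ae ?_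
    (ae_restrict_of_ae (h.contDensity_bondPoint_ae_eq hy φ b).symm)
  simpa only [Finset.sum_fn] using IntervalIntegrable.sum 𝒯 fun T _ =>
    (intervalIntegrable_chi_tri T b).mul_const (φ ‖dirDeriv b.2 y (barycenter T)‖)

theorem contContrib_eq_sum (h : IsTriangulation 𝒯 ω) (hy : IsP1 𝒯 y) (φ : ℝ → ℝ)
    (b : Lattice × Lattice) :
    contContrib ω φ y b
      = ∑ T ∈ 𝒯, bondAverage b (chi (tri T)) * φ ‖dirDeriv b.2 y (barycenter T)‖ := by
  rw [contContrib, bondAverage, intervalIntegral.integral_congr_ae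
      ((h.contDensity_bondPoint_ae_eq hy φ b).mono fun t ht _ => ht),
    intervalIntegral.integral_finsetSum fun T _ => (intervalIntegrable_chi_tri T b).mul_const _]
  simp only [intervalIntegral.integral_mul_const, bondAverage]

theorem sum_contContrib (h : IsTriangulation 𝒯 ω) (hy : IsP1 𝒯 y) (φ : ℝ → ℝ)
    {R : Finset Lattice} {B : Finset (Lattice × Lattice)} (hBR : ∀ b ∈ B, b.2 ∈ R) :
    ∑ b ∈ B, contContrib ω φ y b
      = ∑ T ∈ 𝒯, ∑ r ∈ R, coverage B T r * φ ‖dirDeriv r y (barycenter T)‖ := by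
  simp only [h.contContrib_eq_sum hy]
  rw [Finset.sum_comm]
  exact Finset.sum_congr rfl fun T _ =>
    sum_bondAverage_chi_tri_mul hBR T fun r => φ ‖dirDeriv r y (barycenter T)‖

theorem cauchyBornDensity_eqOn_interior_tri (h : IsTriangulation 𝒯 ω) (hy : IsP1 𝒯 y)
    (hT : T ∈ 𝒯) (R : Finset Lattice) (φ : ℝ → ℝ) :
    Set.EqOn (cauchyBornDensity R φ y) (fun _ => cauchyBornDensity R φ y (barycenter T))
      (interior (tri T)) := fun x hx =>
  Finset.sum_congr rfl fun r _ => by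
    rw [h.dirDeriv_eq_dirDeriv_barycenter hy hT
      (eventually_add_smul_mem (mem_interior_iff_mem_nhds.1 hx) _)]

theorem integrableOn_interior_cauchyBornDensity (h : IsTriangulation 𝒯 ω) (hy : IsP1 𝒯 y)
    (hT : T ∈ 𝒯) (R : Finset Lattice) (φ : ℝ → ℝ) :
    IntegrableOn (cauchyBornDensity R φ y) (interior (tri T)) := by
  have hconst : IntegrableOn (fun _ => cauchyBornDensity R φ y (barycenter T))
      (interior (tri T)) :=
    integrableOn_const
      (measure_ne_top_of_subset interior_subset (isCompact_tri T).measure_lt_top.ne)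
  exact hconst.congr_fun (h.cauchyBornDensity_eqOn_interior_tri hy hT R φ).symm
    isOpen_interior.measurableSet

theorem integrableOn_cauchyBornDensity (h : IsTriangulation 𝒯 ω) (hy : IsP1 𝒯 y)
    (R : Finset Lattice) (φ : ℝ → ℝ) : IntegrableOn (cauchyBornDensity R φ y) ω := by
  rw [integrableOn_congr_set_ae h.ae_eq_biUnion_interior, integrableOn_finset_iUnion]
  exact fun T hT => h.integrableOn_interior_cauchyBornDensity hy hT R φ

theorem contEnergy_eq_contEnergyTri (h : IsTriangulation 𝒯 ω) (hy : IsP1 𝒯 y)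
    (R : Finset Lattice) (φ : ℝ → ℝ) : contEnergy ω R φ y = contEnergyTri 𝒯 R φ y := by
  rw [contEnergy, setIntegral_congr_set h.ae_eq_biUnion_interior,
    integral_biUnion_finset 𝒯 (fun T _ => isOpen_interior.measurableSet)
      (fun T hT T' hT' hne => h.nonoverlapping T hT T' hT' hne)
      (fun T hT => h.integrableOn_interior_cauchyBornDensity hy hT R φ)]
  refine Finset.sum_congr rfl fun T hT => ?_
  rw [setIntegral_congr_fun isOpen_interior.measurableSet
    (h.cauchyBornDensity_eqOn_interior_tri hy hT R φ), setIntegral_const,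
    measureReal_congr (interior_tri_ae_eq T), smul_eq_mul, cauchyBornDensity, Finset.mul_sum]

theorem finsum_contContrib_bonds (h : IsTriangulation 𝒯 ω) (hy : IsP1 𝒯 y) {Ω : Set Plane}
    (hΩ : Bornology.IsBounded Ω) {R : Finset Lattice}
    (hbdry : ∀ r ∈ R, ∀ i : Lattice, (seg (i, r) ∩ closure ω).Nonempty →
      site i ∈ Ω ∧ site (i + r) ∈ Ω) (φ : ℝ → ℝ) :
    ∑ᶠ b ∈ bonds Ω R, contContrib ω φ y b = contEnergyTri 𝒯 R φ y := by
  have hfin := bonds_finite hΩ R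
  rw [finsum_mem_eq_finite_toFinset_sum _ hfin,
    h.sum_contContrib hy φ fun b hb => (hfin.mem_toFinset.1 hb).1]
  refine Finset.sum_congr rfl fun T hT => Finset.sum_congr rfl fun r hr => ?_
  rw [h.coverage_eq_volume hT fun i hi => hfin.mem_toFinset.2 ⟨hr, hbdry r hr i hi⟩]

end Deformation

end IsTriangulation

theorem contContrib_eq_innerContContrib {ω : Set Plane} (hω : IsOpen ω) (φ : ℝ → ℝ)
    (y : Plane → Plane) {b : Lattice × Lattice} (hb : seg b ⊆ ω) :
    contContrib ω φ y b = innerContContrib φ y b :=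
  bondAverage_congr fun x hx => by
    rw [contDensity, chi_eq_one_of_mem_nhds (hω.mem_nhds (hb hx)), one_mul]

theorem eccEnergy_eq_finsum_contContrib {ω : Set Plane} (hω : IsOpen ω) (Ω : Set Plane)
    (R : Finset Lattice) (φ : ℝ → ℝ) (y : Plane → Plane) :
    eccEnergy Ω ω R φ y = (∑ᶠ b ∈ outerBonds Ω ω R, exactContrib φ y b)
      + ∑ᶠ b ∈ innerBonds Ω ω R, contContrib ω φ y b := by
  rw [eccEnergy]
  congr 1
  exact finsum_mem_congr rfl fun b hb => (contContrib_eq_innerContContrib hω φ y hb.2).symm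

theorem finite_outerBonds {Ω : Set Plane} (hΩ : Bornology.IsBounded Ω) (ω : Set Plane)
    (R : Finset Lattice) : (outerBonds Ω ω R).Finite :=
  (bonds_finite hΩ R).subset (Set.sep_subset _ _)

theorem finite_innerBonds {Ω : Set Plane} (hΩ : Bornology.IsBounded Ω) (ω : Set Plane)
    (R : Finset Lattice) : (innerBonds Ω ω R).Finite :=
  (bonds_finite hΩ R).subset (Set.sep_subset _ _)

theorem finsum_bonds_eq_add {Ω : Set Plane} (hΩ : Bornology.IsBounded Ω) (ω : Set Plane)
    (R : Finset Lattice) (f : Lattice × Lattice → ℝ) :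
    ∑ᶠ b ∈ bonds Ω R, f b
      = (∑ᶠ b ∈ outerBonds Ω ω R, f b) + ∑ᶠ b ∈ innerBonds Ω ω R, f b := by
  have hunion : bonds Ω R = outerBonds Ω ω R ∪ innerBonds Ω ω R := by
    ext b
    simp only [outerBonds, innerBonds, Set.mem_union, Set.mem_ofPred_eq]
    tauto
  rw [hunion, finsum_mem_union (Set.disjoint_left.2 fun _ hout hin => hout.2 hin.2)
    (finite_outerBonds hΩ ω R) (finite_innerBonds hΩ ω R)]

theorem IsTriangulation.eccEnergy_eq {𝒯 : Finset (Finset Lattice)} {Ω ω : Set Plane}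
    {y : Plane → Plane} (h : IsTriangulation 𝒯 ω) (hy : IsP1 𝒯 y) (hΩ : Bornology.IsBounded Ω)
    {R : Finset Lattice}
    (hbdry : ∀ r ∈ R, ∀ i : Lattice, (seg (i, r) ∩ closure ω).Nonempty →
      site i ∈ Ω ∧ site (i + r) ∈ Ω) (φ : ℝ → ℝ) :
    eccEnergy Ω ω R φ y
      = (∑ᶠ b ∈ outerBonds Ω ω R, (exactContrib φ y b - contContrib ω φ y b))
        + contEnergyTri 𝒯 R φ y := by
  rw [← h.finsum_contContrib_bonds hy hΩ hbdry, finsum_bonds_eq_add hΩ ω,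
    finsum_mem_sub_distrib (f := exactContrib φ y) (g := contContrib ω φ y)
      (finite_outerBonds hΩ ω R), eccEnergy_eq_finsum_contContrib h.isOpen]
  ring

theorem affineMap_apply_eq_sum_coord {ι 𝕜 V W : Type*} [Fintype ι] [Ring 𝕜] [AddCommGroup V]
    [Module 𝕜 V] [AddCommGroup W] [Module 𝕜 W] (β : AffineBasis ι 𝕜 V) (A : V →ᵃ[𝕜] W) (x : V) :
    A x = ∑ i, β.coord i x • A (β i) := by
  have hone : ∑ i, β.coord i x = 1 := β.sum_coord_apply_eq_one x
  nth_rw 1 [← β.affineCombination_coord_eq_self x]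
  rw [Finset.map_affineCombination _ _ _ hone,
    Finset.affineCombination_eq_linear_combination _ _ _ hone]
  rfl

theorem affineMap_linear_eq_sum_coord {ι 𝕜 V W : Type*} [Fintype ι] [Ring 𝕜] [AddCommGroup V]
    [Module 𝕜 V] [AddCommGroup W] [Module 𝕜 W] (β : AffineBasis ι 𝕜 V) (A : V →ᵃ[𝕜] W) (v : V) :
    A.linear v = ∑ i, (β.coord i).linear v • A (β i) := by
  simp only [AffineMap.decomp', Pi.sub_apply, sub_smul, Finset.sum_sub_distrib,
    ← affineMap_apply_eq_sum_coord]

theorem dirDeriv_barycenter_eq_sum {T : Finset Lattice} (hcard : T.card = 3)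
    (hindep : AffineIndependent ℝ fun v : T => site v) {y : Plane → Plane}
    {A : Plane →ᵃ[ℝ] Plane} (hA : Set.EqOn y A (tri T)) (r : Lattice) :
    dirDeriv r y (barycenter T)
      = ∑ v : T, ((vertexBasis hcard hindep).coord v).linear (site r) • y (site v) := by
  have hvertex : ∀ v : T, y (site v) = A (vertexBasis hcard hindep v) := fun v =>
    hA (subset_convexHull ℝ _ ⟨v, v.2, rfl⟩)
  have hbary := mem_interior_iff_mem_nhds.1 (barycenter_mem_interior_tri hcard hindep)
  rw [dirDeriv_eq_linear hA (eventually_add_smul_mem hbary _),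
    affineMap_linear_eq_sum_coord (vertexBasis hcard hindep)]
  simp only [hvertex]

namespace Computation

/-- The computation of a finite sum, as iterated additions starting from `0`. -/
noncomputable def sum {α : Type*} (s : Finset α) (p : α → Computation) : Computation :=
  (s.toList.map p).foldr .add (.const 0)

theorem value_sum (φ : ℝ → ℝ) (y : Plane → Plane) {α : Type*} (s : Finset α)
    (p : α → Computation) : (sum s p).value φ y = ∑ a ∈ s, (p a).value φ y := by
  rw [← Finset.sum_map_toList, sum]
  induction s.toList with
  | nil => rfl
  | cons a l ih => simp [value, ih]

theorem cost_sum_le {α : Type*} {s : Finset α} {p : α → Computation} {c : ℕ}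
    (h : ∀ a ∈ s, (p a).cost ≤ c) : (sum s p).cost ≤ (c + 1) * s.card := by
  simp only [← Finset.mem_toList] at h
  rw [← Finset.length_toList, sum]
  generalize s.toList = l at h ⊢
  induction l with
  | nil => rfl
  | cons a l ih =>
    have ha := h a List.mem_cons_self
    have hl := ih fun b hb => h b (List.mem_cons_of_mem a hb)
    simp only [List.map_cons, List.foldr_cons, cost, List.length_cons]
    linarith

/-- The computation of the exact contribution of a bond. -/
def exactBond (b : Lattice × Lattice) : Computation :=
  .potential (.sub (.coord (b.1 + b.2) 0) (.coord b.1 0))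
    (.sub (.coord (b.1 + b.2) 1) (.coord b.1 1))

theorem value_exactBond (φ : ℝ → ℝ) (y : Plane → Plane) (b : Lattice × Lattice) :
    (exactBond b).value φ y = exactContrib φ y b := by
  simp only [exactBond, value, exactContrib]
  congr 2
  ext k
  fin_cases k <;> simp

section Triangle

variable {T : Finset Lattice} (hcard : T.card = 3)
  (hindep : AffineIndependent ℝ fun v : T => site v) (r : Lattice)

/-- The computation of the coordinate `k` of `D_r y` on the triangle `T` from the values of `y` at
the vertices; the weights are the derivatives of the barycentric coordinates. -/
noncomputable def dirDerivCoord (k : Fin 2) : Computation :=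
  sum Finset.univ fun v : T =>
    .mul (.const (((vertexBasis hcard hindep).coord v).linear (site r))) (.coord v k)

/-- The computation of `c φ(|D_r y|)` on the triangle `T`. -/
noncomputable def triangleTerm (c : ℝ) : Computation :=
  .mul (.const c) (.potential (dirDerivCoord hcard hindep r 0) (dirDerivCoord hcard hindep r 1))

theorem cost_triangleTerm_le (c : ℝ) : (triangleTerm hcard hindep r c).cost ≤ 14 := by
  have hcoord : ∀ k, (dirDerivCoord hcard hindep r k).cost ≤ 6 := fun k => by
    refine (cost_sum_le (c := 1) fun _ _ => le_rfl).trans_eq ?_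
    rw [Finset.card_univ, Fintype.card_coe, hcard]
  simp only [triangleTerm, cost]
  linarith [hcoord 0, hcoord 1]

theorem value_triangleTerm (c : ℝ) (φ : ℝ → ℝ) {y : Plane → Plane} {A : Plane →ᵃ[ℝ] Plane}
    (hA : Set.EqOn y A (tri T)) :
    (triangleTerm hcard hindep r c).value φ y = c * φ ‖dirDeriv r y (barycenter T)‖ := by
  simp only [triangleTerm, value, dirDerivCoord, value_sum]
  rw [dirDeriv_barycenter_eq_sum hcard hindep hA]
  congr 3
  ext k
  fin_cases k <;> simp

end Triangle

end Computation

namespace IsTriangulation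

variable {𝒯 : Finset (Finset Lattice)} {Ω ω : Set Plane}

/-- The computation of the ECC energy: one exact term for every bond of `outer`, and one term for
every triangle and direction, in which all the bonds of `inner` are collected. -/
noncomputable def eccComputation (h : IsTriangulation 𝒯 ω) (R : Finset Lattice)
    (outer inner : Finset (Lattice × Lattice)) : Computation :=
  .sum (outer.disjSum (𝒯.attach ×ˢ R)) <| Sum.elim .exactBond fun p =>
    .triangleTerm (h.card_eq p.1 p.1.2) (h.nondegenerate p.1 p.1.2) p.2 (coverage inner p.1 p.2)

theorem cost_eccComputation_le (h : IsTriangulation 𝒯 ω) (R : Finset Lattice)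
    (outer inner : Finset (Lattice × Lattice)) :
    (h.eccComputation R outer inner).cost ≤ 15 * (outer.card + R.card * 𝒯.card) := by
  refine (Computation.cost_sum_le (c := 14) ?_).trans_eq ?_
  · rintro (b | p) _
    · exact (by decide : 3 ≤ 14)
    · exact Computation.cost_triangleTerm_le _ _ _ _
  · rw [Finset.card_disjSum, Finset.card_product, Finset.card_attach, mul_comm R.card]

theorem value_eccComputation (h : IsTriangulation 𝒯 ω) {R : Finset Lattice}
    (outer : Finset (Lattice × Lattice)) {inner : Finset (Lattice × Lattice)}
    (hinner : ∀ b ∈ inner, b.2 ∈ R) (φ : ℝ → ℝ) {y : Plane → Plane} (hy : IsP1 𝒯 y) :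
    (h.eccComputation R outer inner).value φ y
      = ∑ b ∈ outer, exactContrib φ y b + ∑ b ∈ inner, contContrib ω φ y b := by
  rw [eccComputation, Computation.value_sum, Finset.sum_disjSum, h.sum_contContrib hy φ hinner,
    Finset.sum_product, ← Finset.sum_attach 𝒯]
  simp only [Sum.elim_inl, Sum.elim_inr, Computation.value_exactBond]
  congr 1
  refine Finset.sum_congr rfl fun T _ => Finset.sum_congr rfl fun r _ => ?_
  obtain ⟨A, hA⟩ := hy T T.2
  exact Computation.value_triangleTerm _ _ _ _ _ hA

theorem exists_computation_eccEnergy (h : IsTriangulation 𝒯 ω) (hΩ : Bornology.IsBounded Ω)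
    (R : Finset Lattice) :
    ∃ P : Computation, P.cost ≤ 15 * ((outerBonds Ω ω R).ncard + R.card * 𝒯.card) ∧
      ∀ (φ : ℝ → ℝ) (y : Plane → Plane), IsP1 𝒯 y → P.value φ y = eccEnergy Ω ω R φ y := by
  have hout := finite_outerBonds hΩ ω R
  have hin := finite_innerBonds hΩ ω R
  refine ⟨h.eccComputation R hout.toFinset hin.toFinset, ?_, fun φ y hy => ?_⟩
  · rw [Set.ncard_eq_toFinset_card _ hout]
    exact h.cost_eccComputation_le R _ _
  · rw [h.value_eccComputation _ (fun b hb => (hin.mem_toFinset.1 hb).1.1) φ hy,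
      eccEnergy_eq_finsum_contContrib h.isOpen, finsum_mem_eq_finite_toFinset_sum _ hout,
      finsum_mem_eq_finite_toFinset_sum _ hin]

end IsTriangulation

end ECC

theorem theorem4p3_general {Ω Ωc : Set ECC.Plane} (hΩ : Bornology.IsBounded Ω)
    {𝒯 : Finset (Finset ECC.Lattice)} (h𝒯 : ECC.IsTriangulation 𝒯 Ωc) {R : Finset ECC.Lattice}
    (hbdry : ∀ r ∈ R, ∀ i : ECC.Lattice, (ECC.seg (i, r) ∩ closure Ωc).Nonempty →
      ECC.site i ∈ Ω ∧ ECC.site (i + r) ∈ Ω) :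
    (∀ (φ : ℝ → ℝ) (y : ECC.Plane → ECC.Plane), ECC.IsP1 𝒯 y →
      (∀ b ∈ ECC.bonds Ω R, IntervalIntegrable
        (fun t => ECC.contDensity Ωc φ y b (ECC.bondPoint b t)) volume 0 1) ∧
      (∀ b ∈ ECC.innerBonds Ω Ωc R,
        ECC.contContrib Ωc φ y b = ECC.innerContContrib φ y b) ∧
      IntegrableOn (ECC.cauchyBornDensity R φ y) Ωc ∧
      ECC.contEnergy Ωc R φ y = ECC.contEnergyTri 𝒯 R φ y ∧
      ECC.eccEnergy Ω Ωc R φ y =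
        (∑ᶠ b ∈ ECC.outerBonds Ω Ωc R, (ECC.exactContrib φ y b - ECC.contContrib Ωc φ y b))
          + ECC.contEnergyTri 𝒯 R φ y) ∧
    (∃ P : ECC.Computation,
      P.cost ≤ 20 * ((ECC.outerBonds Ω Ωc R).ncard + R.card * 𝒯.card) ∧
      ∀ (φ : ℝ → ℝ) (y : ECC.Plane → ECC.Plane), ECC.IsP1 𝒯 y →
        P.value φ y = ECC.eccEnergy Ω Ωc R φ y) := by
  obtain ⟨P, hcost, hvalue⟩ := h𝒯.exists_computation_eccEnergy hΩ R
  exact ⟨fun φ y hy => ⟨fun b _ => h𝒯.intervalIntegrable_contDensity hy φ b,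
      fun b hb => ECC.contContrib_eq_innerContContrib h𝒯.isOpen φ y hb.2,
      h𝒯.integrableOn_cauchyBornDensity hy R φ, h𝒯.contEnergy_eq_contEnergyTri hy R φ,
      h𝒯.eccEnergy_eq hy hΩ hbdry φ⟩,
    P, hcost.trans (by gcongr; norm_num), hvalue⟩

theorem theorem4p3
    -- the regions: the body, the atomistic region, and the continuum region
    (Ω Ωa Ωc : Set ECC.Plane)
    (hΩ_open : IsOpen Ω) (hΩ_bdd : Bornology.IsBounded Ω)
    (hΩa_open : IsOpen Ωa) (hΩa_sub : Ωa ⊆ Ω) (hΩc : Ωc = Ω \ closure Ωa)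
    -- the lattice-vertex triangulation of the polygonal continuum region
    (𝒯 : Finset (Finset ECC.Lattice)) (h𝒯 : ECC.IsTriangulation 𝒯 Ωc)
    -- the set of neighbours
    (R : Finset ECC.Lattice) (hR : (0 : ECC.Lattice) ∉ R)
    -- every bond that meets the closed continuum region has both its ends in the body
    (hbdry : ∀ r ∈ R, ∀ i : ECC.Lattice, (ECC.seg (i, r) ∩ closure Ωc).Nonempty →
      ECC.site i ∈ Ω ∧ ECC.site (i + r) ∈ Ω) :
    (∀ (φ : ℝ → ℝ) (y : ECC.Plane → ECC.Plane), ECC.IsP1 𝒯 y →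
      -- the contributions `c_b` are well defined, and extend those of the bonds inside `Ωc`
      (∀ b ∈ ECC.bonds Ω R, IntervalIntegrable
        (fun t => ECC.contDensity Ωc φ y b (ECC.bondPoint b t)) MeasureTheory.volume 0 1) ∧
      (∀ b ∈ ECC.innerBonds Ω Ωc R,
        ECC.contContrib Ωc φ y b = ECC.innerContContrib φ y b) ∧
      -- the two expressions of the Cauchy--Born energy agree
      MeasureTheory.IntegrableOn (ECC.cauchyBornDensity R φ y) Ωc ∧
      ECC.contEnergy Ωc R φ y = ECC.contEnergyTri 𝒯 R φ y ∧
      -- the representation of the ECC energy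
      ECC.eccEnergy Ω Ωc R φ y =
        (∑ᶠ b ∈ ECC.outerBonds Ω Ωc R, (ECC.exactContrib φ y b - ECC.contContrib Ωc φ y b))
          + ECC.contEnergyTri 𝒯 R φ y) ∧
    -- the cost of computing the ECC energy
    (∃ P : ECC.Computation,
      P.cost ≤ 20 * ((ECC.outerBonds Ω Ωc R).ncard + R.card * 𝒯.card) ∧
      ∀ (φ : ℝ → ℝ) (y : ECC.Plane → ECC.Plane), ECC.IsP1 𝒯 y →
        P.value φ y = ECC.eccEnergy Ω Ωc R φ y) :=
  theorem4p3_general hΩ_bdd h𝒯 hbdry
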